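/- Let $G$ be a (discrete) group, $H\le G$ a subgroup such that $(G,H)$ is a Hecke pair, i.e. $[H:H\cap xHx^{-1}]<\infty$ for all $x\in G$, and let $\sigma$ be a unitary representation of $H$ on a finite-dimensional complex Hilbert space $V_\sigma$ with finite range $\sigma(H)$. Put $K=\ker\sigma$ and assume that the Hecke triple $(G,H,\sigma)$ is reduced, i.e. $\bigcap_{x\in G}xKx^{-1}=\{e\}$. Let $$l^2(G,H,\sigma)=\Bigl\{\xi:G\to V_\sigma \Bigm| \xi(xh)=\sigma(h^{-1})\xi(x)\ \ (x\in G,\ h\in H),\ \sum_{xH\in G/H}\|\xi(x)\|^2<\infty\Bigr\}$$ with inner product $\sum_{xH\in G/H}(\xi(x)\mid\eta(x))$, and let $\lambda_\sigma=\operatorname{Ind}_H^G\sigma$ be the induced representation, $(\lambda_\sigma(x)\xi)(y)=\xi(x^{-1}y)$. Let $\mathcal H_\sigma(G,H)$ be the generalised Hecke algebra of all $f:G\to\mathcal B(V_\sigma)$ with finite support in $H\backslash G/H$ and $f(hxk)=\sigma(h)f(x)\sigma(k)$ for $h,k\in H$, $x\in G$. It acts on $l^2(G,H,\sigma)$ by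 the bounded operators $$(\widetilde R(f)\xi)(y)=\sum_{zH\in G/H}\Delta_K(z)^{1/2}f(z)\,\xi(yz),\qquad \Delta_K(z)=\frac{[K:K\cap zKz^{-1}]}{[K:K\cap z^{-1}Kz]}.$$ Let $\mathcal R(G,H,\sigma)$ be the von Neumann algebra generated by $\widetilde R(\mathcal H_\sigma(G,H))$ in $\mathcal B(l^2(G,H,\sigma))$. Then the commutant of the induced representation is this von Neumann algebra: $$\lambda_\sigma(G)'=\mathcal R(G,H,\sigma).$$ -/

import Mathlib

noncomputable section

open scoped ENNReal

/-- The conjugate subgroup `x L x⁻¹`. -/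
def conjSubgroup {G : Type*} [Group G] (L : Subgroup G) (x : G) : Subgroup G :=
  L.map (MulAut.conj x).toMonoidHom

theorem conjSubgroup_mul {G : Type*} [Group G] (L : Subgroup G) (x y : G) :
    conjSubgroup L (x * y) = conjSubgroup (conjSubgroup L y) x := by
  unfold conjSubgroup
  rw [Subgroup.map_map, map_mul]
  rfl

/-- `(G, H)` is a Hecke pair: `H ∩ x H x⁻¹` has finite index in `H` for every `x`
(equivalently, every double coset `H x H` is a finite union of left cosets). -/
def IsHeckePair {G : Type*} [Group G] (H : Subgroup G) : Prop :=
  ∀ x : G, (conjSubgroup H x).relIndex H ≠ 0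

/-- The pair `(G, H)` is reduced: the intersection of all conjugates `x H x⁻¹` is trivial. -/
def IsReducedPair {G : Type*} [Group G] (H : Subgroup G) : Prop :=
  ⨅ x : G, conjSubgroup H x = ⊥

/-- The function `Δ_H(x) = [H : H ∩ x H x⁻¹] / [H : H ∩ x⁻¹ H x]` of a Hecke pair. -/
def heckeModular {G : Type*} [Group G] (H : Subgroup G) (x : G) : ℝ :=
  ((conjSubgroup H x).relIndex H : ℝ) / ((conjSubgroup H x⁻¹).relIndex H : ℝ)

/-- A Hecke triple `(G, H, σ)`: a Hecke pair `(G, H)` and a unitary representation `σ` of `H`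
on `V` (a finite-dimensional Hilbert space in all that follows) whose range is finite. -/
structure HeckeTriple (G : Type*) [Group G] (V : Type*) [NormedAddCommGroup V]
    [InnerProductSpace ℂ V] where
  /-- the subgroup -/
  H : Subgroup G
  /-- the unitary representation -/
  σ : H →* (V ≃ₗᵢ[ℂ] V)
  isHeckePair : IsHeckePair H
  finite_range : (Set.range σ).Finite

namespace HeckeTriple

variable {G : Type*} [Group G] {V : Type*} [NormedAddCommGroup V] [InnerProductSpace ℂ V]

/-- The kernel `K` of `σ`, as a subgroup of `G`. -/
def K (T : HeckeTriple G V) : Subgroup G := T.σ.ker.map T.H.subtype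

/-- A Hecke triple is reduced if the pair `(G, ker σ)` is reduced. -/
def IsReduced (T : HeckeTriple G V) : Prop := IsReducedPair T.K

/-! ### The Hilbert space of the induced representation -/

theorem memℓp_iff {ι : Type*} (f : ι → V) :
    Memℓp f 2 ↔ Summable fun i => ‖f i‖ ^ 2 := by
  rw [memℓp_gen_iff (by norm_num)]
  simp

/-- The vector space of all `f : G → V` with `f (x h) = σ(h⁻¹) f(x)` and
`∑_{x ∈ G/H} ‖f x‖² < ∞`. -/
def l2Submodule (T : HeckeTriple G V) : Submodule ℂ (G → V) where
  carrier := {f | (∀ (x : G) (h : T.H), f (x * h) = T.σ h⁻¹ (f x)) ∧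
    Summable fun q : G ⧸ T.H => ‖f q.out‖ ^ 2}
  add_mem' := by
    rintro f g ⟨hf, hf'⟩ ⟨hg, hg'⟩
    refine ⟨fun x h => by simp [hf, hg], ?_⟩
    exact (memℓp_iff _).1 (((memℓp_iff _).2 hf').add ((memℓp_iff _).2 hg'))
  zero_mem' := ⟨fun x h => by simp, by simp⟩
  smul_mem' := by
    rintro c f ⟨hf, hf'⟩
    refine ⟨fun x h => by simp [hf], ?_⟩
    exact (memℓp_iff _).1 (((memℓp_iff _).2 hf').const_smul c)

/-- The space `l²(G, H, σ)`. -/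
def l2 (T : HeckeTriple G V) : Type _ := ↥T.l2Submodule

instance (T : HeckeTriple G V) : AddCommGroup T.l2 := inferInstanceAs (AddCommGroup T.l2Submodule)

instance (T : HeckeTriple G V) : Module ℂ T.l2 := inferInstanceAs (Module ℂ T.l2Submodule)

/-- Elements of `l²(G, H, σ)` are functions on `G`. -/
instance (T : HeckeTriple G V) : FunLike T.l2 G V where
  coe f := Subtype.val (p := fun f : G → V => f ∈ T.l2Submodule) f
  coe_injective := Subtype.val_injective

/-- The element of `l²(G, H, σ)` given by a function with the required properties. -/
def mkL2 (T : HeckeTriple G V) (f : G → V)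
    (h1 : ∀ (x : G) (h : T.H), f (x * h) = T.σ h⁻¹ (f x))
    (h2 : Summable fun q : G ⧸ T.H => ‖f q.out‖ ^ 2) : T.l2 :=
  show ↥T.l2Submodule from ⟨f, h1, h2⟩

@[simp] theorem mkL2_apply (T : HeckeTriple G V) (f : G → V)
    (h1 : ∀ (x : G) (h : T.H), f (x * h) = T.σ h⁻¹ (f x))
    (h2 : Summable fun q : G ⧸ T.H => ‖f q.out‖ ^ 2) (x : G) : T.mkL2 f h1 h2 x = f x := rfl

theorem l2_ext {T : HeckeTriple G V} {f g : T.l2} (h : ∀ x, f x = g x) : f = g :=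
  DFunLike.ext f g h

theorem summable_norm_sq {T : HeckeTriple G V} (f : T.l2) :
    Summable fun q : G ⧸ T.H => ‖f q.out‖ ^ 2 :=
  (show ↥T.l2Submodule from f).2.2

@[simp] theorem add_apply {T : HeckeTriple G V} (f g : T.l2) (x : G) : (f + g) x = f x + g x := rfl

@[simp] theorem smul_apply {T : HeckeTriple G V} (c : ℂ) (f : T.l2) (x : G) :
    (c • f) x = c • f x := rfl

theorem apply_mul {T : HeckeTriple G V} (f : T.l2) (x : G) (h : T.H) :
    f (x * h) = T.σ h⁻¹ (f x) :=
  (show ↥T.l2Submodule from f).2.1 x h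

/-- Restriction of a function in `l²(G, H, σ)` to a set of representatives of `G/H`. -/
def toLp (T : HeckeTriple G V) : T.l2 →ₗ[ℂ] lp (fun _ : G ⧸ T.H => V) 2 where
  toFun f := ⟨fun q => f q.out, (memℓp_iff _).2 (summable_norm_sq f)⟩
  map_add' _ _ := rfl
  map_smul' _ _ := rfl

@[simp] theorem toLp_apply {T : HeckeTriple G V} (f : T.l2) (q : G ⧸ T.H) :
    T.toLp f q = f q.out := rfl

/-- The element of `H` by which `x` differs from the representative of its coset. -/
def cocycle (T : HeckeTriple G V) (x : G) : T.H :=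
  ⟨(QuotientGroup.mk x : G ⧸ T.H).out⁻¹ * x,
    QuotientGroup.eq.1 (QuotientGroup.out_eq' (QuotientGroup.mk x : G ⧸ T.H))⟩

theorem out_mul_cocycle (T : HeckeTriple G V) (x : G) :
    (QuotientGroup.mk x : G ⧸ T.H).out * T.cocycle x = x := by
  simp [cocycle]

theorem toLp_injective (T : HeckeTriple G V) : Function.Injective T.toLp := by
  intro f g h
  refine l2_ext fun x => ?_
  have h1 : f (QuotientGroup.mk x : G ⧸ T.H).out = g (QuotientGroup.mk x : G ⧸ T.H).out := by
    rw [← toLp_apply, ← toLp_apply, h]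
  rw [← T.out_mul_cocycle x, apply_mul, apply_mul, h1]

theorem toLp_surjective (T : HeckeTriple G V) : Function.Surjective T.toLp := by
  intro a
  have hc (x : G) (h : T.H) : T.cocycle (x * h) = T.cocycle x * h := by
    apply Subtype.ext
    simp [cocycle, mul_assoc]
  have ho (q : G ⧸ T.H) : T.cocycle q.out = 1 := by
    apply Subtype.ext
    simp [cocycle]
  let b : G ⧸ T.H → V := fun q => a q
  refine ⟨T.mkL2 (fun x => T.σ (T.cocycle x)⁻¹ (b (QuotientGroup.mk x))) (fun x h => ?_) ?_, ?_⟩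
  · have hm : (QuotientGroup.mk (x * h) : G ⧸ T.H) = QuotientGroup.mk x :=
      QuotientGroup.mk_mul_of_mem x h.2
    rw [hc, hm]
    simp
  · have := (memℓp_iff b).1 a.2
    simpa [ho] using this
  · ext q
    rw [toLp_apply, mkL2_apply]
    simp [ho, b]

instance (T : HeckeTriple G V) : NormedAddCommGroup T.l2 :=
  NormedAddCommGroup.induced T.l2 (lp (fun _ : G ⧸ T.H => V) 2) T.toLp T.toLp_injective

theorem norm_toLp {T : HeckeTriple G V} (f : T.l2) : ‖T.toLp f‖ = ‖f‖ := rfl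

/-- The inner product `⟪f, g⟫ = ∑_{x ∈ G/H} ⟪f x, g x⟫`, see `l2_inner_eq_tsum`. -/
instance (T : HeckeTriple G V) : InnerProductSpace ℂ T.l2 where
  toNormedSpace := NormedSpace.induced ℂ T.l2 (lp (fun _ : G ⧸ T.H => V) 2) T.toLp
  inner f g := inner ℂ (T.toLp f) (T.toLp g)
  norm_sq_eq_re_inner f := by
    rw [← norm_toLp]
    exact norm_sq_eq_re_inner (𝕜 := ℂ) (T.toLp f)
  conj_inner_symm f g := inner_conj_symm (𝕜 := ℂ) (T.toLp f) (T.toLp g)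
  add_left f g k := by
    rw [map_add]
    exact inner_add_left (𝕜 := ℂ) (T.toLp f) (T.toLp g) (T.toLp k)
  smul_left f g c := by
    rw [map_smul]
    exact inner_smul_left (𝕜 := ℂ) (T.toLp f) (T.toLp g) c

theorem l2_inner_eq_tsum {T : HeckeTriple G V} (f g : T.l2) :
    inner ℂ f g = ∑' q : G ⧸ T.H, inner ℂ (f q.out) (g q.out) :=
  lp.inner_eq_tsum (𝕜 := ℂ) (T.toLp f) (T.toLp g)

theorem l2_norm_sq {T : HeckeTriple G V} (f : T.l2) :
    ‖f‖ ^ 2 = ∑' q : G ⧸ T.H, ‖f q.out‖ ^ 2 := by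
  have h := lp.norm_rpow_eq_tsum (p := 2) (by norm_num) (T.toLp f)
  simpa [norm_toLp] using h

instance [FiniteDimensional ℂ V] (T : HeckeTriple G V) : CompleteSpace T.l2 := by
  have : CompleteSpace V := FiniteDimensional.complete ℂ V
  let e : T.l2 ≃ₗᵢ[ℂ] lp (fun _ : G ⧸ T.H => V) 2 :=
    { LinearEquiv.ofBijective T.toLp ⟨T.toLp_injective, T.toLp_surjective⟩ with
      norm_map' := fun f => norm_toLp f }
  exact (completeSpace_congr e.isometry.isUniformInducing.isUniformEmbedding
    (e := e.toEquiv)).2 inferInstance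

theorem norm_out {T : HeckeTriple G V} (f : T.l2) (x : G) :
    ‖f (QuotientGroup.mk x : G ⧸ T.H).out‖ = ‖f x‖ := by
  conv_rhs => rw [← T.out_mul_cocycle x, apply_mul, LinearIsometryEquiv.norm_map]

/-! ### The induced representation -/

theorem hasSum_translate {T : HeckeTriple G V} (x : G) (f : T.l2) :
    HasSum (fun q : G ⧸ T.H => ‖f (x⁻¹ * q.out)‖ ^ 2) (‖f‖ ^ 2) := by
  have h : HasSum (fun q : G ⧸ T.H => ‖f q.out‖ ^ 2) (‖f‖ ^ 2) := by
    rw [l2_norm_sq]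
    exact (summable_norm_sq f).hasSum
  rw [← (MulAction.toPerm (x⁻¹) : Equiv.Perm (G ⧸ T.H)).hasSum_iff] at h
  convert h using 2 with q
  rw [← norm_out f (x⁻¹ * q.out)]
  congr 4
  exact congrArg (x⁻¹ • ·) (QuotientGroup.out_eq' q)

/-- Left translation `f ↦ f(x⁻¹ ·)` on `l²(G, H, σ)`, as a linear isometry. -/
def translate (T : HeckeTriple G V) (x : G) : T.l2 →ₗᵢ[ℂ] T.l2 where
  toFun f := T.mkL2 (fun y => f (x⁻¹ * y)) (fun y h => by rw [← mul_assoc, apply_mul])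
    (hasSum_translate x f).summable
  map_add' _ _ := rfl
  map_smul' _ _ := rfl
  norm_map' f := by
    have h : ∀ a b : ℝ, 0 ≤ a → 0 ≤ b → a ^ 2 = b ^ 2 → a = b := fun a b ha hb hab =>
      (sq_eq_sq₀ ha hb).1 hab
    refine h _ _ (norm_nonneg _) (norm_nonneg _) ?_
    rw [l2_norm_sq]
    exact (hasSum_translate x f).tsum_eq

/-- The induced representation `λ_σ = Ind_H^G σ` on `l²(G, H, σ)`,
`(λ_σ(x) f)(y) = f(x⁻¹ y)`. -/
def inducedRep (T : HeckeTriple G V) : G →* (T.l2 →L[ℂ] T.l2) where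
  toFun x := (T.translate x).toContinuousLinearMap
  map_one' := by
    ext f
    refine l2_ext fun y => ?_
    change f (1⁻¹ * y) = f y
    simp
  map_mul' x y := by
    ext f
    refine l2_ext fun z => ?_
    change f ((x * y)⁻¹ * z) = f (y⁻¹ * (x⁻¹ * z))
    simp [mul_assoc]

theorem inducedRep_apply (T : HeckeTriple G V) (x : G) (f : T.l2) (y : G) :
    T.inducedRep x f y = f (x⁻¹ * y) := rfl

/-! ### The generalised Hecke algebra -/

/-- The (space underlying the) generalised Hecke algebra `ℋ_σ(G, H)`: all `f : G → B(V)` with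
finite support in `H \ G / H` such that `f (h x k) = σ(h) f(x) σ(k)`. -/
def heckeAlgebra (T : HeckeTriple G V) : Submodule ℂ (G → (V →L[ℂ] V)) where
  carrier := {f | (∀ (h k : T.H) (x : G) (v : V), f (h * x * k) v = T.σ h (f x (T.σ k v))) ∧
    (DoubleCoset.mk T.H T.H '' Function.support f).Finite}
  add_mem' := by
    rintro f g ⟨hf, hf'⟩ ⟨hg, hg'⟩
    refine ⟨fun h k x v => by simp [hf, hg], ?_⟩
    refine (hf'.union hg').subset ?_
    rw [← Set.image_union]
    exact Set.image_mono (Function.support_add f g)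
  zero_mem' := ⟨fun h k x v => by simp, by simp⟩
  smul_mem' := by
    rintro c f ⟨hf, hf'⟩
    refine ⟨fun h k x v => by simp [hf], hf'.subset (Set.image_mono ?_)⟩
    exact Function.support_const_smul_subset c f

theorem finite_cosets (T : HeckeTriple G V) {A : Set G}
    (hA : (DoubleCoset.mk T.H T.H '' A).Finite) :
    ((QuotientGroup.mk : G → G ⧸ T.H) '' A).Finite := by
  have key (x : G) : (Set.range fun h : T.H => (QuotientGroup.mk (h * x) : G ⧸ T.H)).Finite := by
    have hfin : Finite (T.H ⧸ (conjSubgroup T.H x).subgroupOf T.H) :=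
      Nat.finite_of_card_ne_zero (T.isHeckePair x)
    let φ : T.H ⧸ (conjSubgroup T.H x).subgroupOf T.H → G ⧸ T.H :=
      Quotient.lift (fun h : T.H => (QuotientGroup.mk (h * x) : G ⧸ T.H)) (by
        intro a b hab
        have hab' : a⁻¹ * b ∈ (conjSubgroup T.H x).subgroupOf T.H :=
          QuotientGroup.leftRel_apply.1 hab
        obtain ⟨t, ht, hte⟩ := hab'
        refine QuotientGroup.eq.2 ?_
        have hte' : x * t * x⁻¹ = (a : G)⁻¹ * b := hte
        have : ((a : G) * x)⁻¹ * (b * x) = t := by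
          rw [mul_inv_rev, mul_assoc, ← mul_assoc (a : G)⁻¹, ← hte']
          group
        rw [this]
        exact ht)
    refine (Set.finite_range φ).subset ?_
    rintro _ ⟨h, rfl⟩
    exact ⟨QuotientGroup.mk h, rfl⟩
  refine (hA.biUnion fun D _ => key D.out).subset ?_
  rintro _ ⟨a, ha, rfl⟩
  refine Set.mem_biUnion ⟨a, ha, rfl⟩ ?_
  obtain ⟨h, k, hh, hk, e⟩ := DoubleCoset.mk_out_eq_mul T.H T.H a
  refine ⟨⟨h⁻¹, T.H.inv_mem hh⟩, ?_⟩
  change (QuotientGroup.mk (h⁻¹ * (DoubleCoset.mk T.H T.H a).out) : G ⧸ T.H) = QuotientGroup.mk a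
  rw [e]
  refine QuotientGroup.eq.2 ?_
  simpa [mul_assoc] using T.H.inv_mem hk

theorem finite_inv (T : HeckeTriple G V) {A : Set G}
    (hA : (DoubleCoset.mk T.H T.H '' A).Finite) :
    (DoubleCoset.mk T.H T.H '' {x | x⁻¹ ∈ A}).Finite := by
  refine (hA.image fun D => DoubleCoset.mk T.H T.H D.out⁻¹).subset ?_
  rintro _ ⟨a, ha, rfl⟩
  refine ⟨_, ⟨a⁻¹, ha, rfl⟩, ?_⟩
  obtain ⟨h, k, hh, hk, e⟩ := DoubleCoset.mk_out_eq_mul T.H T.H a⁻¹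
  change DoubleCoset.mk T.H T.H (DoubleCoset.mk T.H T.H a⁻¹).out⁻¹ = DoubleCoset.mk T.H T.H a
  rw [e, DoubleCoset.eq]
  exact ⟨k, hk, h, hh, by group⟩

/-! ### The right action of the generalised Hecke algebra -/

theorem conj_K (T : HeckeTriple G V) (h : T.H) : conjSubgroup T.K h = T.K := by
  have key (h : T.H) : conjSubgroup T.K h ≤ T.K := by
    rintro _ ⟨_, ⟨k, hk, rfl⟩, rfl⟩
    refine ⟨h * k * h⁻¹, ?_, by simp⟩
    exact (T.σ.normal_ker).conj_mem k hk h
  refine le_antisymm (key h) ?_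
  have h1 := Subgroup.map_mono (f := (MulAut.conj (h : G)).toMonoidHom) (key h⁻¹)
  change conjSubgroup (conjSubgroup T.K (h⁻¹ : T.H)) (h : G) ≤ conjSubgroup T.K h at h1
  rw [← conjSubgroup_mul] at h1
  refine le_trans (le_of_eq ?_) h1
  have h2 : (h : G) * ((h⁻¹ : T.H) : G) = 1 := by simp
  rw [h2]
  ext k
  simp [conjSubgroup]

theorem relIndex_conj_K (T : HeckeTriple G V) (h k : T.H) (x : G) :
    (conjSubgroup T.K (h * x * k)).relIndex T.K = (conjSubgroup T.K x).relIndex T.K := by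
  rw [conjSubgroup_mul, conj_K, conjSubgroup_mul]
  have h1 : (conjSubgroup (conjSubgroup T.K x) h).relIndex (conjSubgroup T.K h) =
      (conjSubgroup T.K x).relIndex T.K :=
    Subgroup.relIndex_map_map_of_injective (f := (MulAut.conj (h : G)).toMonoidHom) _ _
      (MulAut.conj (h : G)).injective
  rwa [conj_K] at h1

theorem heckeModular_mul (T : HeckeTriple G V) (h k : T.H) (x : G) :
    heckeModular T.K (h * x * k) = heckeModular T.K x := by
  unfold heckeModular
  rw [relIndex_conj_K]
  have : ((h : G) * x * k)⁻¹ = (k⁻¹ : T.H) * x⁻¹ * (h⁻¹ : T.H) := by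
    simp [mul_assoc]
  rw [this, relIndex_conj_K]

/-- The function `z ↦ Δ_K(z)^{1/2} f(z) ξ(y z)` on `G`, which is constant on left cosets of `H`. -/
def rightSummand (T : HeckeTriple G V) (f : T.heckeAlgebra) (ξ : G → V) (y z : G) : V :=
  ((Real.sqrt (heckeModular T.K z) : ℝ) : ℂ) • f.1 z (ξ (y * z))

theorem rightSummand_mul (T : HeckeTriple G V) (f : T.heckeAlgebra) (ξ : T.l2) (y z : G)
    (h : T.H) : T.rightSummand f ξ y (z * h) = T.rightSummand f ξ y z := by
  have h1 := T.heckeModular_mul 1 h z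
  have h2 := f.2.1 1 h z
  simp only [OneMemClass.coe_one, one_mul, map_one] at h1 h2
  unfold rightSummand
  rw [h1, h2, ← mul_assoc, apply_mul]
  simp

theorem rightSummand_out (T : HeckeTriple G V) (f : T.heckeAlgebra) (ξ : T.l2) (y z : G) :
    T.rightSummand f ξ y (QuotientGroup.mk z : G ⧸ T.H).out = T.rightSummand f ξ y z := by
  conv_rhs => rw [← T.out_mul_cocycle z, rightSummand_mul]

/-- The finite set of left cosets on which `f` does not vanish. -/
def cosetSupport (T : HeckeTriple G V) (f : T.heckeAlgebra) : Finset (G ⧸ T.H) :=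
  (T.finite_cosets f.2.2).toFinset

/-- The finite set of left cosets on which `x ↦ f(x⁻¹)` does not vanish. -/
def cosetSupportInv (T : HeckeTriple G V) (f : T.heckeAlgebra) : Finset (G ⧸ T.H) :=
  (T.finite_cosets (T.finite_inv f.2.2)).toFinset

theorem mem_cosetSupport {T : HeckeTriple G V} {f : T.heckeAlgebra} {q : G ⧸ T.H} :
    q ∈ T.cosetSupport f ↔ ∃ x, f.1 x ≠ 0 ∧ QuotientGroup.mk x = q := by
  simp [cosetSupport]

theorem mem_cosetSupportInv {T : HeckeTriple G V} {f : T.heckeAlgebra} {q : G ⧸ T.H} :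
    q ∈ T.cosetSupportInv f ↔ ∃ x, f.1 x⁻¹ ≠ 0 ∧ QuotientGroup.mk x = q := by
  simp [cosetSupportInv]

/-- The operator `(R̃(f) ξ)(y) = ∑_{z ∈ G/H} Δ_K(z)^{1/2} f(z) ξ(y z)` on functions. -/
def rightFun (T : HeckeTriple G V) (f : T.heckeAlgebra) (ξ : G → V) (y : G) : V :=
  ∑ᶠ q : G ⧸ T.H,
    ((Real.sqrt (heckeModular T.K q.out) : ℝ) : ℂ) • f.1 q.out (ξ (y * q.out))

theorem rightFun_eq_finsum (T : HeckeTriple G V) (f : T.heckeAlgebra) (ξ : G → V) (y : G) :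
    T.rightFun f ξ y = ∑ᶠ q : G ⧸ T.H, T.rightSummand f ξ y q.out := rfl

theorem rightFun_eq_sum (T : HeckeTriple G V) (f : T.heckeAlgebra) (ξ : G → V) (y : G) :
    T.rightFun f ξ y = ∑ q ∈ T.cosetSupport f, T.rightSummand f ξ y q.out := by
  refine finsum_eq_sum_of_support_subset _ ?_
  intro q hq
  refine Finset.mem_coe.2 (mem_cosetSupport.2 ⟨q.out, ?_, QuotientGroup.out_eq' q⟩)
  intro h0
  exact hq (by simp [h0])

theorem rightFun_mul (T : HeckeTriple G V) (f : T.heckeAlgebra) (ξ : T.l2) (y : G) (h : T.H) :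
    T.rightFun f ξ (y * h) = T.σ h⁻¹ (T.rightFun f ξ y) := by
  have key (z : G) : T.rightSummand f ξ (y * h) z = T.σ h⁻¹ (T.rightSummand f ξ y (h * z)) := by
    have h1 := T.heckeModular_mul h 1 z
    have h2 := f.2.1 h 1 z
    simp only [OneMemClass.coe_one, mul_one, map_one] at h1 h2
    unfold rightSummand
    rw [h1, h2, map_smul, mul_assoc]
    simp
  have hsupp : (Function.support fun q : G ⧸ T.H => T.rightSummand f ξ y q.out).Finite := by
    refine (T.cosetSupport f).finite_toSet.subset ?_
    intro q hq
    refine Finset.mem_coe.2 (mem_cosetSupport.2 ⟨q.out, ?_, QuotientGroup.out_eq' q⟩)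
    intro h0
    exact hq (by simp [rightSummand, h0])
  rw [rightFun_eq_finsum, rightFun_eq_finsum]
  have h3 := (T.σ h⁻¹).toLinearEquiv.toLinearMap.toAddMonoidHom.map_finsum hsupp
  refine Eq.trans ?_ h3.symm
  refine finsum_eq_of_bijective (fun q => (h : G) • q)
    (MulAction.bijective (h : G)) ?_
  intro q
  rw [key]
  change _ = T.σ h⁻¹ (T.rightSummand f ξ y ((h : G) • q).out)
  congr 1
  rw [← rightSummand_out]
  congr 2
  conv_rhs => rw [← QuotientGroup.out_eq' q]
  rfl

/-- A bound for the square of the norm of the operator given by `f`. -/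
def rightBound (T : HeckeTriple G V) (f : T.heckeAlgebra) : ℝ :=
  (T.cosetSupport f).card * (T.cosetSupportInv f).card *
    (∑ q ∈ T.cosetSupport f, Real.sqrt (heckeModular T.K q.out) * ‖f.1 q.out‖) ^ 2

theorem rightBound_nonneg (T : HeckeTriple G V) (f : T.heckeAlgebra) : 0 ≤ T.rightBound f := by
  unfold rightBound
  positivity

theorem norm_rightFun_sq_le (T : HeckeTriple G V) (f : T.heckeAlgebra) (ξ : T.l2) (y : G) :
    ‖T.rightFun f ξ y‖ ^ 2 ≤ (T.cosetSupport f).card *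
      (∑ q ∈ T.cosetSupport f, Real.sqrt (heckeModular T.K q.out) * ‖f.1 q.out‖) ^ 2 *
      ∑ q ∈ T.cosetSupport f, ‖ξ (y * q.out)‖ ^ 2 := by
  set C := ∑ q ∈ T.cosetSupport f, Real.sqrt (heckeModular T.K q.out) * ‖f.1 q.out‖ with hC
  have h0 (q : G ⧸ T.H) : 0 ≤ Real.sqrt (heckeModular T.K q.out) * ‖f.1 q.out‖ := by positivity
  have hC0 : 0 ≤ C := Finset.sum_nonneg fun q _ => h0 q
  have h1 : ‖T.rightFun f ξ y‖ ≤ C * ∑ q ∈ T.cosetSupport f, ‖ξ (y * q.out)‖ := by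
    rw [rightFun_eq_sum, Finset.mul_sum]
    refine (norm_sum_le _ _).trans (Finset.sum_le_sum fun q hq => ?_)
    unfold rightSummand
    rw [norm_smul, Complex.norm_real, Real.norm_of_nonneg (Real.sqrt_nonneg _)]
    calc Real.sqrt (heckeModular T.K q.out) * ‖f.1 q.out (ξ (y * q.out))‖
        ≤ Real.sqrt (heckeModular T.K q.out) * (‖f.1 q.out‖ * ‖ξ (y * q.out)‖) := by
          gcongr
          exact (f.1 q.out).le_opNorm _
      _ = Real.sqrt (heckeModular T.K q.out) * ‖f.1 q.out‖ * ‖ξ (y * q.out)‖ := by ring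
      _ ≤ C * ‖ξ (y * q.out)‖ := by
          gcongr
          exact Finset.single_le_sum (fun q _ => h0 q) hq
  calc ‖T.rightFun f ξ y‖ ^ 2
      ≤ (C * ∑ q ∈ T.cosetSupport f, ‖ξ (y * q.out)‖) ^ 2 := by gcongr
    _ = C ^ 2 * (∑ q ∈ T.cosetSupport f, ‖ξ (y * q.out)‖) ^ 2 := by ring
    _ ≤ C ^ 2 * ((T.cosetSupport f).card * ∑ q ∈ T.cosetSupport f, ‖ξ (y * q.out)‖ ^ 2) := by
        gcongr
        exact sq_sum_le_card_mul_sum_sq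
    _ = _ := by ring

open Classical in
theorem tsum_overlap_le (T : HeckeTriple G V) (f : T.heckeAlgebra) (a : G ⧸ T.H → ℝ≥0∞) :
    ∑' p : G ⧸ T.H, ∑ q ∈ T.cosetSupport f, a (p.out • q) ≤
      (T.cosetSupportInv f).card * ∑' w, a w := by
  have h1 (p : G ⧸ T.H) : ∑ q ∈ T.cosetSupport f, a (p.out • q) =
      ∑' w, if p.out⁻¹ • w ∈ T.cosetSupport f then a w else 0 := by
    rw [← (MulAction.toPerm p.out : Equiv.Perm (G ⧸ T.H)).tsum_eq]
    simp only [MulAction.toPerm_apply, inv_smul_smul]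
    rw [tsum_eq_sum (s := T.cosetSupport f) (fun q hq => by simp [hq])]
    exact Finset.sum_congr rfl fun q hq => by simp [hq]
  have h2 (p w : G ⧸ T.H) (h : p.out⁻¹ • w ∈ T.cosetSupport f) :
      w.out⁻¹ • p ∈ T.cosetSupportInv f := by
    obtain ⟨x, hx, hxe⟩ := mem_cosetSupport.1 h
    refine mem_cosetSupportInv.2 ⟨w.out⁻¹ * p.out, ?_, ?_⟩
    · have h3 : p.out⁻¹ • w = QuotientGroup.mk (p.out⁻¹ * w.out) := by
        conv_lhs => rw [← QuotientGroup.out_eq' w]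
        rfl
      rw [h3] at hxe
      have hm : x⁻¹ * (p.out⁻¹ * w.out) ∈ T.H := QuotientGroup.eq.1 hxe
      intro h0
      apply hx
      have h4 : (w.out⁻¹ * p.out)⁻¹ = p.out⁻¹ * w.out := by group
      rw [h4] at h0
      have h5 := f.2.1 1 ⟨_, T.H.inv_mem hm⟩ (p.out⁻¹ * w.out)
      have h10 : ((1 : T.H) : G) * (p.out⁻¹ * w.out) * (x⁻¹ * (p.out⁻¹ * w.out))⁻¹ = x := by
        rw [OneMemClass.coe_one]
        group
      ext v
      have h6 := h5 v
      simp only [h10] at h6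
      rw [h6, h0]
      simp
    · conv_rhs => rw [← QuotientGroup.out_eq' p]
      rfl
  have h7 (w : G ⧸ T.H) : ∑' p : G ⧸ T.H, (if p.out⁻¹ • w ∈ T.cosetSupport f then a w else 0) ≤
      (T.cosetSupportInv f).card * a w := by
    calc ∑' p : G ⧸ T.H, (if p.out⁻¹ • w ∈ T.cosetSupport f then a w else 0)
        ≤ ∑' p : G ⧸ T.H, (if w.out⁻¹ • p ∈ T.cosetSupportInv f then a w else 0) := by
          refine ENNReal.tsum_le_tsum fun p => ?_
          split_ifs with h8 h9
          · exact le_rfl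
          · exact absurd (h2 p w h8) h9
          · exact zero_le
          · exact le_rfl
      _ = ∑' p : G ⧸ T.H, (if p ∈ T.cosetSupportInv f then a w else 0) :=
          (MulAction.toPerm (w.out⁻¹) : Equiv.Perm (G ⧸ T.H)).tsum_eq
            (fun p => if p ∈ T.cosetSupportInv f then a w else 0)
      _ = (T.cosetSupportInv f).card * a w := by
          rw [tsum_eq_sum (s := T.cosetSupportInv f) (fun q hq => by simp [hq])]
          rw [Finset.sum_congr rfl fun q hq => if_pos hq]
          simp
  simp_rw [h1]
  rw [ENNReal.tsum_comm, ← ENNReal.tsum_mul_left]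
  exact ENNReal.tsum_le_tsum h7

theorem tsum_rightFun_le (T : HeckeTriple G V) (f : T.heckeAlgebra) (ξ : T.l2) :
    ∑' p : G ⧸ T.H, ENNReal.ofReal (‖T.rightFun f ξ p.out‖ ^ 2) ≤
      ENNReal.ofReal (T.rightBound f * ‖ξ‖ ^ 2) := by
  set D : ℝ := (T.cosetSupport f).card *
      (∑ q ∈ T.cosetSupport f, Real.sqrt (heckeModular T.K q.out) * ‖f.1 q.out‖) ^ 2 with hD
  have hD0 : 0 ≤ D := by positivity
  have h1 : ENNReal.ofReal (‖ξ‖ ^ 2) = ∑' q : G ⧸ T.H, ENNReal.ofReal (‖ξ q.out‖ ^ 2) := by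
    rw [l2_norm_sq]
    exact ENNReal.ofReal_tsum_of_nonneg (fun _ => by positivity) (summable_norm_sq ξ)
  have h2 (p : G ⧸ T.H) : ENNReal.ofReal (‖T.rightFun f ξ p.out‖ ^ 2) ≤
      ENNReal.ofReal D * ∑ q ∈ T.cosetSupport f,
        ENNReal.ofReal (‖ξ ((p.out • q : G ⧸ T.H)).out‖ ^ 2) := by
    refine (ENNReal.ofReal_le_ofReal (T.norm_rightFun_sq_le f ξ p.out)).trans ?_
    rw [ENNReal.ofReal_mul hD0, ENNReal.ofReal_sum_of_nonneg (fun _ _ => by positivity)]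
    refine le_of_eq ?_
    congr 1
    refine Finset.sum_congr rfl fun q _ => ?_
    rw [← norm_out ξ (p.out * q.out)]
    congr 5
    conv_rhs => rw [← QuotientGroup.out_eq' q]
    rfl
  calc ∑' p : G ⧸ T.H, ENNReal.ofReal (‖T.rightFun f ξ p.out‖ ^ 2)
      ≤ ∑' p : G ⧸ T.H, ENNReal.ofReal D * ∑ q ∈ T.cosetSupport f,
        ENNReal.ofReal (‖ξ ((p.out • q : G ⧸ T.H)).out‖ ^ 2) := ENNReal.tsum_le_tsum h2
    _ ≤ ENNReal.ofReal D * ((T.cosetSupportInv f).card * ENNReal.ofReal (‖ξ‖ ^ 2)) := by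
        rw [ENNReal.tsum_mul_left, h1]
        gcongr
        exact T.tsum_overlap_le f fun w => ENNReal.ofReal (‖ξ w.out‖ ^ 2)
    _ = ENNReal.ofReal (T.rightBound f * ‖ξ‖ ^ 2) := by
        have h3 : T.rightBound f * ‖ξ‖ ^ 2 = D * ((T.cosetSupportInv f).card * ‖ξ‖ ^ 2) := by
          rw [rightBound, hD]
          ring
        rw [h3, ENNReal.ofReal_mul hD0,
          ENNReal.ofReal_mul (Nat.cast_nonneg (T.cosetSupportInv f).card), ENNReal.ofReal_natCast]

theorem summable_rightFun (T : HeckeTriple G V) (f : T.heckeAlgebra) (ξ : T.l2) :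
    Summable fun p : G ⧸ T.H => ‖T.rightFun f ξ p.out‖ ^ 2 := by
  have h1 := ne_top_of_le_ne_top ENNReal.ofReal_ne_top (T.tsum_rightFun_le f ξ)
  have h2 := ENNReal.summable_toReal h1
  refine h2.congr fun p => ?_
  exact ENNReal.toReal_ofReal (by positivity)

/-- The action `R̃(f)` of `f ∈ ℋ_σ(G, H)` as a bounded operator on `l²(G, H, σ)`. -/
def rightAction (T : HeckeTriple G V) (f : T.heckeAlgebra) : T.l2 →L[ℂ] T.l2 :=
  LinearMap.mkContinuous
    { toFun := fun ξ => T.mkL2 (T.rightFun f ξ) (T.rightFun_mul f ξ) (T.summable_rightFun f ξ)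
      map_add' := fun ξ η => l2_ext fun y => by
        change T.rightFun f (ξ + η : T.l2) y = T.rightFun f ξ y + T.rightFun f η y
        simp only [rightFun_eq_sum, ← Finset.sum_add_distrib]
        exact Finset.sum_congr rfl fun q _ => by simp [rightSummand]
      map_smul' := fun c ξ => l2_ext fun y => by
        change T.rightFun f (c • ξ : T.l2) y = c • T.rightFun f ξ y
        simp only [rightFun_eq_sum, Finset.smul_sum]
        exact Finset.sum_congr rfl fun q _ => by simp [rightSummand, smul_comm c] }
    (Real.sqrt (T.rightBound f)) (fun ξ => by
      refine le_of_sq_le_sq ?_ (by positivity)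
      rw [mul_pow, Real.sq_sqrt (T.rightBound_nonneg f), l2_norm_sq]
      have h1 := T.tsum_rightFun_le f ξ
      rw [← ENNReal.ofReal_tsum_of_nonneg (fun _ => by positivity) (T.summable_rightFun f ξ)] at h1
      exact (ENNReal.ofReal_le_ofReal_iff
        (mul_nonneg (T.rightBound_nonneg f) (by positivity))).1 h1)

theorem rightAction_apply (T : HeckeTriple G V) (f : T.heckeAlgebra) (ξ : T.l2) (y : G) :
    T.rightAction f ξ y = ∑ᶠ q : G ⧸ T.H,
      ((Real.sqrt (heckeModular T.K q.out) : ℝ) : ℂ) • f.1 q.out (ξ (y * q.out)) := rfl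

end HeckeTriple

/-! ### Generated von Neumann algebras -/

/-- The von Neumann algebra generated by a set of bounded operators; it is the smallest one that
contains the set, see `generatedVonNeumannAlgebra_le_iff`. -/
def generatedVonNeumannAlgebra {E : Type*} [NormedAddCommGroup E] [InnerProductSpace ℂ E]
    [CompleteSpace E] (S : Set (E →L[ℂ] E)) : VonNeumannAlgebra E where
  toStarSubalgebra :=
    StarSubalgebra.centralizer ℂ (StarSubalgebra.centralizer ℂ S : Set (E →L[ℂ] E))
  centralizer_centralizer' := by
    change Set.centralizer (Set.centralizer
      ((StarSubalgebra.centralizer ℂ (StarSubalgebra.centralizer ℂ S : Set (E →L[ℂ] E)) :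
        StarSubalgebra ℂ (E →L[ℂ] E)) : Set (E →L[ℂ] E))) = _
    rw [StarSubalgebra.coe_centralizer_centralizer, Set.centralizer_centralizer_centralizer]
    exact (StarSubalgebra.coe_centralizer_centralizer ℂ S).symm

theorem generatedVonNeumannAlgebra_le_iff {E : Type*} [NormedAddCommGroup E]
    [InnerProductSpace ℂ E] [CompleteSpace E] (S : Set (E →L[ℂ] E)) (M : VonNeumannAlgebra E) :
    generatedVonNeumannAlgebra S ≤ M ↔ S ⊆ (M : Set (E →L[ℂ] E)) := by
  have hcoe : (generatedVonNeumannAlgebra S : Set (E →L[ℂ] E)) =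
      Set.centralizer (Set.centralizer (S ∪ star S)) :=
    StarSubalgebra.coe_centralizer_centralizer ℂ S
  rw [← SetLike.coe_subset_coe, hcoe]
  constructor
  · intro h
    exact (Set.subset_union_left.trans Set.subset_centralizer_centralizer).trans h
  · intro h
    rw [← M.centralizer_centralizer]
    refine Set.centralizer_subset (Set.centralizer_subset (Set.union_subset h ?_))
    intro x hx
    have := star_mem (h hx)
    simpa using this

/-- The von Neumann algebra `ℛ(G, H, σ)` generated by `R̃(ℋ_σ(G, H))` in `B(l²(G, H, σ))`. -/
def HeckeTriple.heckeVonNeumannAlgebra {G : Type*} [Group G] {V : Type*} [NormedAddCommGroup V]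
    [InnerProductSpace ℂ V] [FiniteDimensional ℂ V] (T : HeckeTriple G V) :
    VonNeumannAlgebra T.l2 :=
  generatedVonNeumannAlgebra (Set.range T.rightAction)

end

namespace HeckeTriple

section

variable {G : Type*} [Group G] {V : Type*} [NormedAddCommGroup V] [InnerProductSpace ℂ V]

/-! ### The modular function of the kernel does not vanish -/

/-! Right convolutions commute with left translations, and so do their adjoints; hence the generated
algebra lies in the commutant. For the converse, let `B` commute with all `λ_σ(x)` and `A` with all
`R̃(f)`; the claim is `AB = BA`.

Let `δ_v` be the vector supported on `H` with value `v` at `1`. Inner products against `λ_σ(x) δ_v`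
evaluate functions at `x`, so an operator is determined by its matrix entries between such vectors
(`operator_eq_zero`), and `B` by the functions `B δ_v`. Cutting `B δ_v` down to one double coset `D`
gives, after removal of the weight `Δ_K^{1/2}`, an element of the Hecke algebra. Thus `B` is
formally the sum over `D` of operators `B_D = R̃(f_D)` (`block`).

No convergence of `∑ B_D` on the whole space is needed. For translates `υ`, `ω` of delta vectors,
the `B_D υ` are disjointly supported pieces of `B υ`, and the `B_D* ω` of `B* ω`, so both sums
converge weakly (`hasSum_inner_pieces`). Hence `⟪ω, A B υ⟫ = ∑ ⟪A* ω, B_D υ⟫ = ∑ ⟪B_D* ω, A υ⟫ = ⟪ω,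
B A υ⟫`, the middle equality being `A B_D = B_D A`. -/

theorem K_le_H (T : HeckeTriple G V) : T.K ≤ T.H :=
  Subgroup.map_subtype_le _

theorem relIndex_K_ne_zero (T : HeckeTriple G V) : T.K.relIndex T.H ≠ 0 := by
  have h : T.K.subgroupOf T.H = T.σ.ker := Subgroup.comap_map_eq_self_of_injective T.H.subtype_injective _
  have hfin : Finite T.σ.range := T.finite_range
  rw [Subgroup.relIndex, h, Subgroup.index_ker]
  exact Nat.card_pos.ne'

/-- Since `σ(H)` is finite, `xKx⁻¹` has finite index in `xHx⁻¹`, which meets `H` in finite index by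
the Hecke condition; restrict from `H` to `K`. -/
theorem relIndex_conj_K_ne_zero (T : HeckeTriple G V) (x : G) :
    (conjSubgroup T.K x).relIndex T.K ≠ 0 := by
  have h1 : (conjSubgroup T.K x).relIndex (conjSubgroup T.H x) ≠ 0 := by
    rw [conjSubgroup, conjSubgroup, Subgroup.relIndex_map_map_of_injective _ _
      (MulAut.conj x).injective]
    exact T.relIndex_K_ne_zero
  have h2 := Subgroup.relIndex_ne_zero_trans h1 (T.isHeckePair x)
  exact mt (Subgroup.relIndex_eq_zero_of_le_right T.K_le_H) h2

/-- An infinite index would count as `0` and make the quotient `0`. Positivity is what permits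
division by `Δ_K^{1/2}` in `block`. -/
theorem heckeModular_K_pos (T : HeckeTriple G V) (x : G) : 0 < heckeModular T.K x :=
  div_pos (Nat.cast_pos.2 (Nat.pos_of_ne_zero (T.relIndex_conj_K_ne_zero x)))
    (Nat.cast_pos.2 (Nat.pos_of_ne_zero (T.relIndex_conj_K_ne_zero x⁻¹)))

/-! ### Vectors supported on one coset -/

open Classical in
/-- The function on `G` supported on `H` with `h ↦ σ(h⁻¹) v` there. -/
noncomputable def deltaFun (T : HeckeTriple G V) (v : V) (x : G) : V :=
  if h : x ∈ T.H then T.σ (⟨x, h⟩ : T.H)⁻¹ v else 0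

theorem deltaFun_of_notMem (T : HeckeTriple G V) (v : V) {x : G} (hx : x ∉ T.H) :
    T.deltaFun v x = 0 := dif_neg hx

theorem deltaFun_coe (T : HeckeTriple G V) (v : V) (h : T.H) :
    T.deltaFun v h = T.σ h⁻¹ v := dif_pos h.2

theorem out_notMem (T : HeckeTriple G V) {q : G ⧸ T.H} (hq : q ≠ QuotientGroup.mk 1) :
    q.out ∉ T.H := by
  intro h
  apply hq
  rw [← QuotientGroup.out_eq' q, QuotientGroup.eq]
  simpa using h

/-- The element of `l²(G, H, σ)` supported on `H` with value `v` at `1`. -/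
noncomputable def delta (T : HeckeTriple G V) (v : V) : T.l2 :=
  T.mkL2 (T.deltaFun v)
    (fun x h => by
      by_cases hx : x ∈ T.H
      · lift x to T.H using hx
        rw [← Subgroup.coe_mul, deltaFun_coe, deltaFun_coe]
        simp
      · rw [deltaFun_of_notMem _ _ hx, deltaFun_of_notMem, map_zero]
        rwa [Subgroup.mul_mem_cancel_right _ h.2])
    (summable_of_ne_finset_zero (s := {QuotientGroup.mk 1}) fun q hq => by
      rw [deltaFun_of_notMem _ _ (T.out_notMem (by simpa using hq))]
      simp)

theorem delta_of_notMem (T : HeckeTriple G V) (v : V) {x : G} (hx : x ∉ T.H) :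
    T.delta v x = 0 := T.deltaFun_of_notMem v hx

theorem delta_coe (T : HeckeTriple G V) (v : V) (h : T.H) :
    T.delta v h = T.σ h⁻¹ v := T.deltaFun_coe v h

theorem delta_one (T : HeckeTriple G V) (v : V) : T.delta v 1 = v := by
  have := T.delta_coe v 1
  simpa using this

theorem delta_eq_zero_or (T : HeckeTriple G V) (x : G) :
    (∀ v, T.delta v x = 0) ∨ ∃ h : T.H, ∀ v, T.delta v x = T.σ h⁻¹ v := by
  by_cases hx : x ∈ T.H
  · exact .inr ⟨⟨x, hx⟩, fun v => T.delta_coe v ⟨x, hx⟩⟩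
  · exact .inl fun v => T.delta_of_notMem v hx

theorem delta_add (T : HeckeTriple G V) (v w : V) :
    T.delta (v + w) = T.delta v + T.delta w := by
  refine l2_ext fun x => ?_
  rcases T.delta_eq_zero_or x with h | ⟨k, h⟩ <;> simp [h]

theorem delta_smul (T : HeckeTriple G V) (c : ℂ) (v : V) :
    T.delta (c • v) = c • T.delta v := by
  refine l2_ext fun x => ?_
  rcases T.delta_eq_zero_or x with h | ⟨k, h⟩ <;> simp [h]

/-- The delta vectors form a copy of `σ` inside `λ_σ` restricted to `H`; this yields the right
equivariance in `symbol_mul_mul`. -/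
theorem inducedRep_delta (T : HeckeTriple G V) (h : T.H) (v : V) :
    T.inducedRep h (T.delta v) = T.delta (T.σ h v) := by
  refine l2_ext fun x => ?_
  rw [inducedRep_apply]
  by_cases hx : x ∈ T.H
  · lift x to T.H using hx
    have := T.delta_coe v (h⁻¹ * x)
    push_cast at this
    rw [this, delta_coe]
    simp
  · rw [delta_of_notMem _ _ hx, delta_of_notMem]
    rwa [Subgroup.mul_mem_cancel_left _ (T.H.inv_mem h.2)]

/-! ### Matrix entries with respect to translated delta vectors -/

theorem inner_inducedRep (T : HeckeTriple G V) (x : G) (ξ η : T.l2) :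
    inner ℂ (T.inducedRep x ξ) η = inner ℂ ξ (T.inducedRep x⁻¹ η) := by
  have h : T.inducedRep x (T.inducedRep x⁻¹ η) = η := by
    rw [← mul_apply_eq_comp, ← map_mul]
    simp
  conv_lhs => rw [← h]
  exact (T.translate x).inner_map_map _ _

theorem inner_delta (T : HeckeTriple G V) (v : V) (ξ : T.l2) :
    inner ℂ (T.delta v) ξ = inner ℂ v (ξ 1) := by
  rw [l2_inner_eq_tsum, tsum_eq_single (QuotientGroup.mk 1) fun q hq => by
    rw [delta_of_notMem _ _ (T.out_notMem hq), inner_zero_left]]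
  have h : (QuotientGroup.mk 1 : G ⧸ T.H).out ∈ T.H := by
    have h0 := T.out_mul_cocycle 1
    rw [eq_inv_of_mul_eq_one_left h0]
    exact T.H.inv_mem (T.cocycle 1).2
  -- The chosen representative of the coset `H` need not be `1`, but `δ_v` and `ξ` both change by
  -- the same unitary `σ(x⁻¹)`.
  generalize (QuotientGroup.mk 1 : G ⧸ T.H).out = x at h
  lift x to T.H using h
  have h1 := apply_mul ξ 1 x
  rw [one_mul] at h1
  rw [delta_coe, h1, LinearIsometryEquiv.inner_map_map]

/-- A reproducing property: the translated delta vectors represent point evaluations. -/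
theorem inner_inducedRep_delta (T : HeckeTriple G V) (x : G) (v : V) (ξ : T.l2) :
    inner ℂ (T.inducedRep x (T.delta v)) ξ = inner ℂ v (ξ x) := by
  rw [inner_inducedRep, inner_delta, inducedRep_apply]
  simp

theorem eq_zero_of_inner_delta (T : HeckeTriple G V) {ξ : T.l2}
    (h : ∀ x v, inner ℂ (T.inducedRep x (T.delta v)) ξ = 0) : ξ = 0 := by
  refine l2_ext fun x => ?_
  have h1 := h x (ξ x)
  rw [inner_inducedRep_delta, inner_self_eq_zero] at h1
  exact h1

/-- Bounded operators on `l²(G, H, σ)` are determined by their matrix entries. -/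
theorem operator_eq_zero [FiniteDimensional ℂ V] (T : HeckeTriple G V) {B : T.l2 →L[ℂ] T.l2}
    (h : ∀ x w y v, inner ℂ (T.inducedRep x (T.delta w))
      (B (T.inducedRep y (T.delta v))) = 0) : B = 0 := by
  -- The entries show that `B` kills every translated delta vector. Testing `B* ξ` against these
  -- vectors then replaces a density argument.
  have h1 : ContinuousLinearMap.adjoint B = 0 := by
    refine ContinuousLinearMap.ext fun ξ => T.eq_zero_of_inner_delta fun y v => ?_
    rw [ContinuousLinearMap.adjoint_inner_right,
      T.eq_zero_of_inner_delta fun x w => h x w y v, inner_zero_left]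
  simpa using congrArg ContinuousLinearMap.adjoint h1

/-! ### The right action on vectors supported on one coset -/

theorem commute_rightAction_inducedRep (T : HeckeTriple G V) (f : T.heckeAlgebra) (x : G) :
    Commute (T.rightAction f) (T.inducedRep x) := by
  refine ContinuousLinearMap.ext fun ξ => l2_ext fun y => ?_
  change T.rightAction f (T.inducedRep x ξ) y = T.inducedRep x (T.rightAction f ξ) y
  rw [inducedRep_apply, rightAction_apply, rightAction_apply]
  simp only [inducedRep_apply, mul_assoc]

/-- Since `δ_v(yz)` vanishes unless `yz ∈ H`, only the coset `y⁻¹H` contributes. So `R̃(f)` on delta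
vectors recovers `f`, up to inversion and the weight. -/
theorem rightAction_delta (T : HeckeTriple G V) (f : T.heckeAlgebra) (v : V) (y : G) :
    T.rightAction f (T.delta v) y =
      ((Real.sqrt (heckeModular T.K y⁻¹) : ℝ) : ℂ) • f.1 y⁻¹ v := by
  change T.rightFun f (T.delta v) y = _
  rw [rightFun_eq_finsum, finsum_eq_single _ (QuotientGroup.mk y⁻¹), rightSummand_out,
    rightSummand, mul_inv_cancel, delta_one]
  intro q hq
  rw [rightSummand, delta_of_notMem, map_zero, smul_zero]
  intro hm
  apply hq
  rw [← QuotientGroup.out_eq' q, eq_comm, QuotientGroup.eq]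
  simpa using hm

/-! ### Blocks of operators in the commutant of the induced representation -/

theorem apply_inducedRep {T : HeckeTriple G V} {B : T.l2 →L[ℂ] T.l2}
    (hB : ∀ x, Commute (T.inducedRep x) B) (x : G) (ξ : T.l2) (y : G) :
    B (T.inducedRep x ξ) y = B ξ (x⁻¹ * y) := by
  rw [← inducedRep_apply]
  exact congrArg (fun C : T.l2 →L[ℂ] T.l2 => C ξ y) (hB x).symm.eq

theorem doubleCoset_mk_mul_mul (T : HeckeTriple G V) (h k : T.H) (x : G) :
    DoubleCoset.mk T.H T.H (h * x * k) = DoubleCoset.mk T.H T.H x :=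
  ((DoubleCoset.eq T.H T.H _ _).2 ⟨h, h.2, k, k.2, rfl⟩).symm

open Classical in
/-- If `η` is cut into pieces along the level sets of a function `c`, then the inner products
with the pieces add up. -/
theorem hasSum_inner_pieces {T : HeckeTriple G V} {ι : Type*} (ξ η : T.l2) (c : G → ι)
    (p : ι → T.l2) (hp : ∀ i z, p i z = if c z = i then η z else 0) :
    HasSum (fun i => inner ℂ ξ (p i)) (inner ℂ ξ η) := by
  -- The sum over `G/H` giving the inner product is regrouped along the fibres of `c`, sampled at
  -- the representatives.
  have h := (lp.hasSum_inner (𝕜 := ℂ) (T.toLp ξ) (T.toLp η)).tsum_fiberwise fun q => c q.out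
  refine Eq.mp (congrArg (HasSum · _) (funext fun i => ?_)) h
  symm
  rw [l2_inner_eq_tsum]
  refine Eq.trans ?_ (tsum_subtype ((fun q : G ⧸ T.H => c q.out) ⁻¹' {i})
      fun q => inner ℂ (T.toLp ξ q) (T.toLp η q)).symm
  refine tsum_congr fun q => ?_
  rw [hp, Set.indicator_apply]
  simp only [Set.mem_preimage, Set.mem_singleton_iff, toLp_apply]
  split_ifs <;> simp

variable [FiniteDimensional ℂ V]

/-- The operator `v ↦ (B δ_v)(x)` on `V`. -/
noncomputable def symbol (T : HeckeTriple G V) (B : T.l2 →L[ℂ] T.l2) (x : G) : V →L[ℂ] V :=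
  LinearMap.toContinuousLinearMap
    { toFun := fun v => B (T.delta v) x
      map_add' := fun v w => by rw [delta_add, map_add, add_apply]
      map_smul' := fun c v => by rw [delta_smul, map_smul, smul_apply, RingHom.id_apply] }

@[simp] theorem symbol_apply (T : HeckeTriple G V) (B : T.l2 →L[ℂ] T.l2) (x : G) (v : V) :
    T.symbol B x v = B (T.delta v) x := rfl

/-- Inversion swaps the two sides: `h` acts through the equivariance of functions in `l²(G, H, σ)`,
and `k` through `B λ_σ(k) = λ_σ(k) B` and `λ_σ(k) δ_v = δ_{σ(k)v}`. -/
theorem symbol_mul_mul {T : HeckeTriple G V} {B : T.l2 →L[ℂ] T.l2}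
    (hB : ∀ x, Commute (T.inducedRep x) B) (h k : T.H) (x : G) (v : V) :
    T.symbol B (h * x * k)⁻¹ v = T.σ h (T.symbol B x⁻¹ (T.σ k v)) := by
  have h1 : ((h : G) * x * k)⁻¹ = (k : G)⁻¹ * x⁻¹ * (h⁻¹ : T.H) := by
    push_cast
    group
  rw [symbol_apply, symbol_apply, h1, apply_mul, ← inducedRep_delta, apply_inducedRep hB, inv_inv]

open Classical in
/-- The element of `ℋ_σ(G, H)` whose right action has the same matrix entries as `B` on the
double coset `D`, and all others zero. -/
noncomputable def block (T : HeckeTriple G V) (B : T.l2 →L[ℂ] T.l2) (hB : ∀ x, Commute (T.inducedRep x) B)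
    (D : DoubleCoset.Quotient (T.H : Set G) T.H) : T.heckeAlgebra :=
  -- The inverse of `x` and the inverse weight undo those in `rightAction_delta`; the support
  -- therefore lies in `D⁻¹`, a single double coset.
  ⟨fun x => if DoubleCoset.mk T.H T.H x⁻¹ = D then
      ((Real.sqrt (heckeModular T.K x) : ℝ) : ℂ)⁻¹ • T.symbol B x⁻¹ else 0, by
    refine ⟨fun h k x v => ?_, ?_⟩
    · have h1 : ((h : G) * x * k)⁻¹ = (k⁻¹ : T.H) * x⁻¹ * (h⁻¹ : T.H) := by
        push_cast
        group
      have h2 : DoubleCoset.mk T.H T.H ((h : G) * x * k)⁻¹ = DoubleCoset.mk T.H T.H x⁻¹ := by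
        rw [h1, doubleCoset_mk_mul_mul]
      simp only [h2, heckeModular_mul]
      split_ifs
      · rw [_root_.smul_apply, symbol_mul_mul hB, _root_.smul_apply,
          map_smul]
      · simp
    · refine (T.finite_inv (A := {x | DoubleCoset.mk T.H T.H x = D})
        ((Set.finite_singleton D).subset ?_)).subset (Set.image_mono fun x hx => ?_)
      · rintro _ ⟨x, hx, rfl⟩
        exact hx
      · by_contra h
        exact hx (if_neg h)⟩

open Classical in
theorem rightAction_block {T : HeckeTriple G V} {B : T.l2 →L[ℂ] T.l2}
    (hB : ∀ x, Commute (T.inducedRep x) B) (D : DoubleCoset.Quotient (T.H : Set G) T.H)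
    (y : G) (v : V) (z : G) :
    T.rightAction (T.block B hB D) (T.inducedRep y (T.delta v)) z =
      if DoubleCoset.mk T.H T.H (y⁻¹ * z) = D then B (T.inducedRep y (T.delta v)) z else 0 := by
  rw [apply_inducedRep (fun x => (T.commute_rightAction_inducedRep _ x).symm),
    apply_inducedRep hB, rightAction_delta]
  have h : ((Real.sqrt (heckeModular T.K (y⁻¹ * z)⁻¹) : ℝ) : ℂ) ≠ 0 :=
    Complex.ofReal_ne_zero.2 (Real.sqrt_pos.2 (T.heckeModular_K_pos _)).ne'
  simp only [block, inv_inv]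
  split_ifs
  · rw [_root_.smul_apply, smul_inv_smul₀ h, symbol_apply]
  · simp

open Classical in
-- Passing to adjoints exchanges rows and columns of the matrix, so `y⁻¹z` in `rightAction_block`
-- becomes `z⁻¹x`.
theorem adjoint_rightAction_block {T : HeckeTriple G V} {B : T.l2 →L[ℂ] T.l2}
    (hB : ∀ x, Commute (T.inducedRep x) B) (D : DoubleCoset.Quotient (T.H : Set G) T.H)
    (x : G) (w : V) (z : G) :
    ContinuousLinearMap.adjoint (T.rightAction (T.block B hB D))
        (T.inducedRep x (T.delta w)) z =
      if DoubleCoset.mk T.H T.H (z⁻¹ * x) = D then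
        ContinuousLinearMap.adjoint B (T.inducedRep x (T.delta w)) z else 0 := by
  refine ext_inner_left ℂ fun v => ?_
  rw [← inner_inducedRep_delta, ContinuousLinearMap.adjoint_inner_right, ← inner_conj_symm,
    inner_inducedRep_delta, rightAction_block]
  split_ifs
  · rw [← inner_inducedRep_delta, inner_conj_symm, ← ContinuousLinearMap.adjoint_inner_right,
      inner_inducedRep_delta]
  · simp

/-! ### Commutation by summing over double cosets -/

theorem commute_of_commute_rightAction {T : HeckeTriple G V} {A B : T.l2 →L[ℂ] T.l2}
    (hB : ∀ x, Commute (T.inducedRep x) B) (hA : ∀ f, Commute (T.rightAction f) A) :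
    A * B = B * A := by
  classical
  refine sub_eq_zero.1 (T.operator_eq_zero fun x w y v => ?_)
  set ω := T.inducedRep x (T.delta w)
  set υ := T.inducedRep y (T.delta v)
  have h1 := hasSum_inner_pieces (ContinuousLinearMap.adjoint A ω) (B υ)
    (fun z => DoubleCoset.mk T.H T.H (y⁻¹ * z))
    (fun D => T.rightAction (T.block B hB D) υ)
    fun D z => rightAction_block hB D y v z
  have h2 := (hasSum_inner_pieces (A υ) (ContinuousLinearMap.adjoint B ω)
    (fun z => DoubleCoset.mk T.H T.H (z⁻¹ * x))
    (fun D => ContinuousLinearMap.adjoint (T.rightAction (T.block B hB D)) ω)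
    fun D z => adjoint_rightAction_block hB D x w z).map (starRingEnd ℂ) Complex.continuous_conj
  have h3 : inner ℂ (ContinuousLinearMap.adjoint A ω) (B υ) =
      starRingEnd ℂ (inner ℂ (A υ) (ContinuousLinearMap.adjoint B ω)) := by
    refine h1.unique ?_
    -- Both series are indexed by double cosets, and their terms agree because `A` commutes with
    -- each block.
    convert h2 using 2 with D
    rw [Function.comp_apply, inner_conj_symm, ContinuousLinearMap.adjoint_inner_left,
      ContinuousLinearMap.adjoint_inner_left]
    exact congrArg (fun C : T.l2 →L[ℂ] T.l2 => inner ℂ ω (C υ)) (hA (T.block B hB D)).symm.eq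
  rw [inner_conj_symm, ContinuousLinearMap.adjoint_inner_left,
    ContinuousLinearMap.adjoint_inner_left] at h3
  rw [sub_apply, inner_sub_right, sub_eq_zero]
  exact h3

theorem adjoint_inducedRep (T : HeckeTriple G V) (x : G) :
    star (T.inducedRep x) = T.inducedRep x⁻¹ := by
  rw [ContinuousLinearMap.star_eq_adjoint, eq_comm, ContinuousLinearMap.eq_adjoint_iff]
  intro ξ η
  rw [inner_inducedRep, inv_inv]

end

end HeckeTriple

theorem theorem4p5 {G : Type*} [Group G] {V : Type*} [NormedAddCommGroup V]
    [InnerProductSpace ℂ V] [FiniteDimensional ℂ V] (T : HeckeTriple G V) (hT : T.IsReduced) :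
    Set.centralizer (Set.range T.inducedRep) =
      (T.heckeVonNeumannAlgebra : Set (T.l2 →L[ℂ] T.l2)) := by
  have hcoe : (T.heckeVonNeumannAlgebra : Set (T.l2 →L[ℂ] T.l2)) = Set.centralizer
      (Set.centralizer (Set.range T.rightAction ∪ star (Set.range T.rightAction))) :=
    StarSubalgebra.coe_centralizer_centralizer ℂ _
  rw [hcoe]
  refine subset_antisymm (fun B hB A hA => ?_) (Set.centralizer_subset ?_)
  · exact HeckeTriple.commute_of_commute_rightAction (fun x => hB _ ⟨x, rfl⟩)
      fun f => hA _ (.inl ⟨f, rfl⟩)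
  · rintro _ ⟨x, rfl⟩ C (⟨f, rfl⟩ | ⟨f, hf⟩)
    · exact (T.commute_rightAction_inducedRep f x).eq
    -- Here `C` is the adjoint of `R̃(f)`, so the relation for `λ_σ(x⁻¹) = λ_σ(x)*` is used and
    -- adjoints are taken.
    · have h := (T.commute_rightAction_inducedRep f x⁻¹).star_star
      rw [hf, star_star, T.adjoint_inducedRep, inv_inv] at h
      exact h.eq
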